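/- Let $\langle M,E\rangle$ be a model of ZFC (not necessarily transitive or well-founded), and suppose that $M\models$ "$\langle X,\tau\rangle$ is a regular Hausdorff topological space" ($X,\tau\in M$, $\tau$ being the set of open sets; the extensions $\{x\in M: M\models x\in X\}$ and $\{O\in M: M\models O\in\tau\}$, which are assumed to be sets, are again denoted $X$ and $\tau$). A *(topological) preinterpretation* of $\langle X,\tau\rangle$ over $M$ is a $T_0$ topological space $\langle\hat X,\hat\tau\rangle$ together with maps $\pi\colon X\to\hat X$ and $\pi\colon\tau\to\hat\tau$ such that 1. for all $x\in X$ and $O\in\tau$: $M\models x\in O$ if and only if $\pi(x)\in\pi(O)$; 2. $\pi$ commutes with finite intersections and arbitrary unions of open sets in $M$: if $F\in M$, $M\models$ "$F\subseteq\tau$ is finite and $P=\bigcap F$" and $P\in\tau$, then $\pi(P)=\bigcap\{\pi(Q): M\models Q\in F\}$ (with $\bigcap\emptyset$ read as the whole space); and if $C\in M$, $M\models$ "$C\subseteq\tau$ and $O=\bigcup C$" and $O\in\tau$, then $\pi(O)=\bigcup\{\pi(Q): M\models Q\in C\}$; 3. $\pi(\emptyset)=\emptyset$ and $\pi(X)=\hat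 X$; 4. $\{\pi(O): O\in\tau\}$ is a basis of the topology $\hat\tau$. For preinterpretations $\pi_0\colon X\to\hat X_0$ and $\pi_1\colon X\to\hat X_1$, a *reduction* of $\pi_0$ to $\pi_1$ is a map $h\colon\hat X_0\to\hat X_1$ such that $\pi_1(x)=h(\pi_0(x))$ for every $x\in X$ and $h^{-1}(\pi_1(O))=\pi_0(O)$ for every $O\in\tau$. Write $\pi_0\le\pi_1$ if such a reduction exists; $\pi_0$ and $\pi_1$ are *equivalent* if there is a reduction of $\pi_0$ to $\pi_1$ which is a bijection of $\hat X_0$ and $\hat X_1$. An *interpretation* of $\langle X,\tau\rangle$ is a $\le$-largest preinterpretation, i.e. a preinterpretation $\pi$ such that $\pi'\le\pi$ for every preinterpretation $\pi'$. **Theorem.** An interpretation of $\langle X,\tau\rangle$ exists, any two interpretations of $\langle X,\tau\rangle$ are equivalent, and the target space $\hat X$ of an interpretation is regular Hausdorff. -/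

import Mathlib

universe u w

namespace SetModel

/-- The only symbol of the language of set theory: the binary relation symbol `∈`. -/
inductive MemSymbol : ℕ → Type
  | mem : MemSymbol 2

/-- The first-order language of set theory. -/
def langSet : FirstOrder.Language where
  Functions := fun _ => Empty
  Relations := MemSymbol

/-- The structure `⟨M, E⟩` for the language of set theory. -/
abbrev memStructure {M : Type u} (E : M → M → Prop) : langSet.Structure M where
  funMap := fun f => Empty.elim f
  RelMap := fun r => match r with
    | MemSymbol.mem => fun v => E (v 0) (v 1)

/-- `⟨M, E⟩ ⊨ φ[v]`, where the free variables of `φ` are numbered by natural numbers. -/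
def Sat {M : Type u} (E : M → M → Prop) (φ : langSet.Formula ℕ) (v : ℕ → M) : Prop :=
  @FirstOrder.Language.Formula.Realize langSet M (memStructure E) ℕ φ v

/-- `⟨M, E⟩ ⊨ ZFC`. Neither well-foundedness nor transitivity of `⟨M, E⟩` is required. -/
structure IsModelZFC {M : Type u} (E : M → M → Prop) : Prop where
  extensionality : ∀ a b, (∀ x, E x a ↔ E x b) → a = b
  foundation : ∀ a, (∃ x, E x a) → ∃ x, E x a ∧ ∀ y, E y x → ¬ E y a
  pairing : ∀ a b, ∃ c, ∀ x, E x c ↔ x = a ∨ x = b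
  union : ∀ a, ∃ b, ∀ x, E x b ↔ ∃ y, E y a ∧ E x y
  powerset : ∀ a, ∃ b, ∀ x, E x b ↔ ∀ y, E y x → E y a
  infinity : ∃ a, (∃ e, E e a ∧ ∀ x, ¬ E x e) ∧
    ∀ x, E x a → ∃ s, E s a ∧ ∀ y, E y s ↔ E y x ∨ y = x
  /-- Separation for `φ`; variable `0` ranges over the elements, the others are parameters. -/
  separation : ∀ (φ : langSet.Formula ℕ) (v : ℕ → M) (a : M),
    ∃ b, ∀ x, E x b ↔ E x a ∧ Sat E φ (Function.update v 0 x)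
  /-- Replacement for `φ`; variable `0` is the argument, variable `1` is the value, the others
  are parameters. -/
  replacement : ∀ (φ : langSet.Formula ℕ) (v : ℕ → M) (a : M),
    (∀ x, E x a → ∀ y z, Sat E φ (Function.update (Function.update v 0 x) 1 y) →
      Sat E φ (Function.update (Function.update v 0 x) 1 z) → y = z) →
    ∃ b, ∀ y, E y b ↔ ∃ x, E x a ∧ Sat E φ (Function.update (Function.update v 0 x) 1 y)
  /-- Every set of nonempty pairwise disjoint sets has a transversal. -/
  choice : ∀ a, (∀ x, E x a → ∃ z, E z x) →
    (∀ x y, E x a → E y a → ∀ z, E z x → E z y → x = y) →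
    ∃ c, ∀ x, E x a → ∃! z, E z x ∧ E z c

section Topology

variable {M : Type u} (E : M → M → Prop)

/-- The extension `{x | M ⊨ x ∈ a}` of an element `a` of `M`. -/
abbrev Ext (a : M) : Type u := {x : M // E x a}

/-- `M ⊨ a ⊆ b`. -/
def Sub (a b : M) : Prop := ∀ x, E x a → E x b

/-- `M ⊨ a = ⋃ C`. -/
def IsUnion (a C : M) : Prop := ∀ x, E x a ↔ ∃ Q, E Q C ∧ E x Q

/-- `M ⊨ a = {x ∈ X | ∀ Q ∈ F, x ∈ Q}`, the intersection of a family `F` of subsets of `X`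
(which is `X` if `F` is empty). -/
def IsInter (X a F : M) : Prop := ∀ x, E x a ↔ E x X ∧ ∀ Q, E Q F → E x Q

/-- `M ⊨ F is finite`: in `M`, every set which contains `∅` and contains `A ∪ {x}` whenever it
contains `A` and `x ∈ F`, contains `F`. -/
def IsFin (F : M) : Prop :=
  ∀ K, (∀ e, (∀ x, ¬ E x e) → E e K) →
    (∀ A x B, E A K → E x F → (∀ y, E y B ↔ E y A ∨ y = x) → E B K) → E F K

/-- `M ⊨ ⟨X, τ⟩ is a topological space`. -/
structure IsTopology (X τ : M) : Prop where
  sub : ∀ O, E O τ → Sub E O X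
  empty_mem : ∃ O, E O τ ∧ ∀ x, ¬ E x O
  whole_mem : E X τ
  inter_mem : ∀ O P, E O τ → E P τ → ∃ Q, E Q τ ∧ ∀ x, E x Q ↔ E x O ∧ E x P
  union_mem : ∀ C, Sub E C τ → ∃ O, E O τ ∧ IsUnion E O C

/-- `M ⊨ C is a closed subset of ⟨X, τ⟩`. -/
def IsClosedIn (X τ C : M) : Prop :=
  Sub E C X ∧ ∃ O, E O τ ∧ ∀ x, E x O ↔ E x X ∧ ¬ E x C

/-- `M ⊨ ⟨X, τ⟩ is a regular Hausdorff space`. -/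
structure IsRegularHausdorff (X τ : M) : Prop where
  isTopology : IsTopology E X τ
  hausdorff : ∀ x y, E x X → E y X → x ≠ y →
    ∃ U V, E U τ ∧ E V τ ∧ E x U ∧ E y V ∧ ∀ z, ¬ (E z U ∧ E z V)
  regular : ∀ C x, IsClosedIn E X τ C → E x X → ¬ E x C →
    ∃ U V, E U τ ∧ E V τ ∧ E x U ∧ Sub E C V ∧ ∀ z, ¬ (E z U ∧ E z V)

/-- A topological preinterpretation over `⟨M, E⟩` of the topological space `⟨X, τ⟩` of `M`.
All topological spaces are required to be `T₀`. -/
structure Preinterpretation (X τ : M) where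
  /-- The target space. -/
  Carrier : Type w
  [top : TopologicalSpace Carrier]
  [t0 : T0Space Carrier]
  /-- The map on points. -/
  pt : Ext E X → Carrier
  /-- The map on open sets. -/
  op : Ext E τ → Set Carrier
  mem_iff : ∀ (x : Ext E X) (O : Ext E τ), E x.1 O.1 ↔ pt x ∈ op O
  map_inter : ∀ (F : M) (P : Ext E τ), Sub E F τ → IsFin E F → IsInter E X P.1 F →
    op P = ⋂ Q ∈ {Q : Ext E τ | E Q.1 F}, op Q
  map_union : ∀ (C : M) (O : Ext E τ), Sub E C τ → IsUnion E O.1 C →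
    op O = ⋃ Q ∈ {Q : Ext E τ | E Q.1 C}, op Q
  map_empty : ∀ O : Ext E τ, (∀ x, ¬ E x O.1) → op O = ∅
  map_whole : ∀ O : Ext E τ, O.1 = X → op O = Set.univ
  basis : TopologicalSpace.IsTopologicalBasis (Set.range op)

attribute [instance] Preinterpretation.top Preinterpretation.t0

variable {E} {X τ : M}

namespace Preinterpretation

/-- `h` is a reduction of `π₀` to `π₁`. -/
def IsReduction (π₀ π₁ : Preinterpretation.{u, w} E X τ) (h : π₀.Carrier → π₁.Carrier) : Prop :=
  π₁.pt = h ∘ π₀.pt ∧ ∀ O, h ⁻¹' π₁.op O = π₀.op O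

/-- `π₀ ≤ π₁`. -/
def Reducible (π₀ π₁ : Preinterpretation.{u, w} E X τ) : Prop :=
  ∃ h : π₀.Carrier → π₁.Carrier, IsReduction π₀ π₁ h

/-- Equivalence of preinterpretations. -/
def Equivalent (π₀ π₁ : Preinterpretation.{u, w} E X τ) : Prop :=
  ∃ h : π₀.Carrier → π₁.Carrier, IsReduction π₀ π₁ h ∧ Function.Bijective h

/-- `π` is an interpretation, i.e. a `≤`-largest preinterpretation. -/
def IsInterpretation (π : Preinterpretation.{u, w} E X τ) : Prop :=
  ∀ π' : Preinterpretation.{u, w} E X τ, Reducible π' π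

end Preinterpretation

end Topology

end SetModel

/-! By `T₀`, a point `y` of a preinterpretation is determined by the family of all `O` with `y ∈
π(O)`. Such a family respects the finite intersections and arbitrary unions that exist in `M`: it is
a point filter. Conversely, all point filters together form a preinterpretation, and sending `y` to
its family reduces any preinterpretation to this one, which is therefore largest. Reductions
preserve these families, which gives uniqueness.

Regularity transfers to every preinterpretation. In `M`, an open `O` is the union of the open `P`
for which some open `Q` satisfies `P ∩ Q = ∅` and `Q ∪ O = X`. Point filters respect this union and
both equations. Hausdorffness then follows from regularity and `T₀`. -/

namespace SetModel

/-! ### Formulas for the instances of separation -/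

section Formulas

open FirstOrder

/-- The atomic formula `s ∈ t`. -/
def memFormula {n : ℕ} (s t : langSet.Term (ℕ ⊕ Fin n)) : langSet.BoundedFormula ℕ n :=
  Language.Relations.boundedFormula₂ (L := langSet) MemSymbol.mem s t

/-- The free variable `i`. -/
def freeVar {n : ℕ} (i : ℕ) : langSet.Term (ℕ ⊕ Fin n) := Language.Term.var (Sum.inl i)

/-- The bound variable `i`. -/
def boundVar {n : ℕ} (i : Fin n) : langSet.Term (ℕ ⊕ Fin n) := Language.Term.var (Sum.inr i)

theorem realize_memFormula {M : Type u} (E : M → M → Prop) {n : ℕ}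
    (s t : langSet.Term (ℕ ⊕ Fin n)) (v : ℕ → M) (xs : Fin n → M) :
    @Language.BoundedFormula.Realize langSet M (memStructure E) ℕ n (memFormula s t) v xs ↔
      E (@Language.Term.realize langSet M (memStructure E) _ (Sum.elim v xs) s)
        (@Language.Term.realize langSet M (memStructure E) _ (Sum.elim v xs) t) := by
  let _ := memStructure E
  exact Language.BoundedFormula.realize_rel₂

/-- The formula `v₀ ∉ v₁`. -/
def notMemFormula : langSet.Formula ℕ := ∼(memFormula (freeVar 0) (freeVar 1))

theorem sat_notMemFormula {M : Type u} (E : M → M → Prop) (v : ℕ → M) :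
    Sat E notMemFormula v ↔ ¬ E (v 0) (v 1) := by
  let _ := memStructure E
  unfold Sat notMemFormula Language.Formula.Realize
  rw [Language.BoundedFormula.realize_not, realize_memFormula]
  rfl

/-- The formula saying that some `Q ∈ v₁` is disjoint from `v₀` and covers `v₃` together with
`v₂`. -/
def wellInsideFormula : langSet.Formula ℕ :=
  Language.BoundedFormula.ex (n := 0)
    (memFormula (boundVar 0) (freeVar 1) ⊓
      (Language.BoundedFormula.all (n := 1)
        (memFormula (boundVar 1) (freeVar 0) ⟹ ∼(memFormula (boundVar 1) (boundVar 0))) ⊓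
      Language.BoundedFormula.all (n := 1)
        (memFormula (boundVar 1) (freeVar 3) ⟹
          (memFormula (boundVar 1) (boundVar 0) ⊔ memFormula (boundVar 1) (freeVar 2)))))

theorem sat_wellInsideFormula {M : Type u} (E : M → M → Prop) (v : ℕ → M) :
    Sat E wellInsideFormula v ↔ ∃ Q, E Q (v 1) ∧ (∀ z, E z (v 0) → ¬ E z Q) ∧
      ∀ z, E z (v 3) → E z Q ∨ E z (v 2) := by
  let _ := memStructure E
  unfold Sat wellInsideFormula Language.Formula.Realize
  simp only [Language.BoundedFormula.realize_ex, Language.BoundedFormula.realize_inf,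
    Language.BoundedFormula.realize_all, Language.BoundedFormula.realize_imp,
    Language.BoundedFormula.realize_not, Language.BoundedFormula.realize_sup, realize_memFormula]
  rfl

end Formulas

/-! ### Arguments inside `M`, and point filters -/

section Model

variable {M : Type u} {E : M → M → Prop}

theorem IsModelZFC.exists_diff (hM : IsModelZFC E) (X O : M) :
    ∃ C, ∀ x, E x C ↔ E x X ∧ ¬ E x O := by
  obtain ⟨C, hC⟩ := hM.separation notMemFormula (fun _ => O) X
  exact ⟨C, fun x => by simpa [sat_notMemFormula] using hC x⟩

/-- The set, in `M`, of all members of `τ` whose closure is contained in `O`. -/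
theorem IsModelZFC.exists_wellInside (hM : IsModelZFC E) (X τ O : M) :
    ∃ C, ∀ P, E P C ↔ E P τ ∧ ∃ Q, E Q τ ∧ (∀ z, E z P → ¬ E z Q) ∧
      ∀ z, E z X → E z Q ∨ E z O := by
  obtain ⟨C, hC⟩ := hM.separation wellInsideFormula
    -- Variable `3` gets the value `X`; the value at `0` is overwritten by separation.
    (fun n => if n = 1 then τ else if n = 2 then O else X) τ
  exact ⟨C, fun P => by simpa [sat_wellInsideFormula] using hC P⟩

/-- Two insertions lead from `∅` through `{a}` to `{a, b}`. -/
theorem IsModelZFC.isFin_pair (hM : IsModelZFC E) {a b c e : M} (he : ∀ x, ¬ E x e)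
    (hc : ∀ x, E x c ↔ x = a ∨ x = b) : IsFin E c := by
  intro K hempty hinsert
  obtain ⟨s, hs⟩ := hM.pairing a a
  have hsK : E s K := hinsert e a s (hempty e he) ((hc a).2 (Or.inl rfl)) fun y => by
    simp [hs, he]
  exact hinsert s b c hsK ((hc b).2 (Or.inr rfl)) fun y => by simp [hs, hc]

variable {X τ : M}

/-- Regularity separates a point of `O` from the closed set `X \ O`. Conversely, a point of `P` is
not in `Q`, so the cover `Q ∪ O` puts it in `O`. -/
theorem IsRegularHausdorff.isUnion_wellInside (hM : IsModelZFC E)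
    (hX : IsRegularHausdorff E X τ) {O C : M} (hO : E O τ)
    (hC : ∀ P, E P C ↔ E P τ ∧ ∃ Q, E Q τ ∧ (∀ z, E z P → ¬ E z Q) ∧
      ∀ z, E z X → E z Q ∨ E z O) : IsUnion E O C := by
  have hOX := hX.isTopology.sub O hO
  intro x
  constructor
  · intro hx
    obtain ⟨D, hD⟩ := hM.exists_diff X O
    have hclosed : IsClosedIn E X τ D := by
      refine ⟨fun y hy => ((hD y).1 hy).1, O, hO, fun y => ?_⟩
      rw [hD]
      exact ⟨fun h => ⟨hOX y h, fun h' => h'.2 h⟩,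
        fun h => by_contra fun h' => h.2 ⟨h.1, h'⟩⟩
    obtain ⟨U, V, hU, hV, hxU, hDV, hUV⟩ :=
      hX.regular D x hclosed (hOX x hx) fun h => ((hD x).1 h).2 hx
    refine ⟨U, (hC U).2 ⟨hU, V, hV, fun z h h' => hUV z ⟨h, h'⟩, fun z hz => ?_⟩, hxU⟩
    by_cases h : E z O
    · exact Or.inr h
    · exact Or.inl (hDV z ((hD z).2 ⟨hz, h⟩))
  · rintro ⟨P, hP, hxP⟩
    obtain ⟨hPτ, Q, -, hPQ, hcover⟩ := (hC P).1 hP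
    exact (hcover x (hX.isTopology.sub P hPτ x hxP)).resolve_left (hPQ x hxP)

/-- A set of open sets which meets the closure conditions that the open neighborhoods of a point
of a preinterpretation satisfy. -/
structure IsPointFilter (E : M → M → Prop) (X τ : M) (S : Set (Ext E τ)) : Prop where
  inter_mem_iff : ∀ (F : M) (P : Ext E τ), Sub E F τ → IsFin E F → IsInter E X P.1 F →
    (P ∈ S ↔ ∀ Q : Ext E τ, E Q.1 F → Q ∈ S)
  union_mem_iff : ∀ (C : M) (O : Ext E τ), Sub E C τ → IsUnion E O.1 C →
    (O ∈ S ↔ ∃ Q : Ext E τ, E Q.1 C ∧ Q ∈ S)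
  empty_notMem : ∀ O : Ext E τ, (∀ x, ¬ E x O.1) → O ∉ S
  whole_mem : ∀ O : Ext E τ, O.1 = X → O ∈ S

theorem isPointFilter_pt (x : Ext E X) : IsPointFilter E X τ {O | E x.1 O.1} where
  inter_mem_iff F P hF _ hP :=
    ⟨fun h Q hQ => ((hP x).1 h).2 Q hQ, fun h => (hP x).2 ⟨x.2, fun Q hQ => h ⟨Q, hF Q hQ⟩ hQ⟩⟩
  union_mem_iff C O hC hO :=
    ⟨fun h => let ⟨Q, hQ, hx⟩ := (hO x).1 h; ⟨⟨Q, hC Q hQ⟩, hQ, hx⟩,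
      fun ⟨Q, hQ, hx⟩ => (hO x).2 ⟨Q, hQ, hx⟩⟩
  empty_notMem O hO := hO x
  whole_mem O hO := by
    change E x.1 O.1
    rw [hO]
    exact x.2

theorem IsPointFilter.mem_and_mem_iff (hM : IsModelZFC E) (hX : IsTopology E X τ)
    {S : Set (Ext E τ)} (hS : IsPointFilter E X τ S) {O P Q : Ext E τ}
    (hQ : ∀ x, E x Q.1 ↔ E x O.1 ∧ E x P.1) : Q ∈ S ↔ O ∈ S ∧ P ∈ S := by
  obtain ⟨e, -, he⟩ := hX.empty_mem
  obtain ⟨F, hF⟩ := hM.pairing O.1 P.1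
  have hFτ : Sub E F τ := fun x hx => by
    rcases (hF x).1 hx with rfl | rfl
    exacts [O.2, P.2]
  rw [hS.inter_mem_iff F Q hFτ (hM.isFin_pair he hF) fun x => ?_]
  · constructor
    · exact fun h => ⟨h O ((hF _).2 (Or.inl rfl)), h P ((hF _).2 (Or.inr rfl))⟩
    · rintro ⟨hO, hP⟩ R hR
      rcases (hF _).1 hR with h | h
      · rwa [Subtype.ext h]
      · rwa [Subtype.ext h]
  · rw [hQ]
    simp only [hF, forall_eq_or_imp, forall_eq]
    exact ⟨fun h => ⟨hX.sub _ O.2 x h.1, h⟩, fun h => h.2⟩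

theorem IsPointFilter.mem_or_mem_iff (hM : IsModelZFC E)
    {S : Set (Ext E τ)} (hS : IsPointFilter E X τ S) {O P Q : Ext E τ}
    (hQ : ∀ x, E x Q.1 ↔ E x O.1 ∨ E x P.1) : Q ∈ S ↔ O ∈ S ∨ P ∈ S := by
  obtain ⟨C, hC⟩ := hM.pairing O.1 P.1
  have hCτ : Sub E C τ := fun x hx => by
    rcases (hC x).1 hx with rfl | rfl
    exacts [O.2, P.2]
  rw [hS.union_mem_iff C Q hCτ fun x => by simp [hQ, hC]]
  constructor
  · rintro ⟨R, hR, hRS⟩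
    rcases (hC _).1 hR with h | h
    · exact Or.inl (Subtype.ext h ▸ hRS)
    · exact Or.inr (Subtype.ext h ▸ hRS)
  · rintro (h | h)
    · exact ⟨O, (hC _).2 (Or.inl rfl), h⟩
    · exact ⟨P, (hC _).2 (Or.inr rfl), h⟩

/-! ### Regularity and uniqueness -/

namespace Preinterpretation

theorem isPointFilter (π : Preinterpretation.{u, w} E X τ) (y : π.Carrier) :
    IsPointFilter E X τ {O | y ∈ π.op O} where
  inter_mem_iff F P hF hfin hP := by
    simp [π.map_inter F P hF hfin hP]
  union_mem_iff C O hC hO := by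
    simp [π.map_union C O hC hO]
  empty_notMem O hO := by simp [π.map_empty O hO]
  whole_mem O hO := by simp [π.map_whole O hO]

theorem eq_of_forall_mem_op_iff (π : Preinterpretation.{u, w} E X τ) {y z : π.Carrier}
    (h : ∀ O, y ∈ π.op O ↔ z ∈ π.op O) : y = z := by
  refine π.basis.inseparable_iff.2 ?_ |>.eq
  rintro _ ⟨O, rfl⟩
  exact h O

theorem regularSpace (hM : IsModelZFC E) (hX : IsRegularHausdorff E X τ)
    (π : Preinterpretation.{u, w} E X τ) : RegularSpace π.Carrier := by
  refine RegularSpace.of_exists_mem_nhds_isClosed_subset fun {y s} hs => ?_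
  obtain ⟨_, ⟨O, rfl⟩, hyO, hOs⟩ := π.basis.mem_nhds_iff.1 hs
  obtain ⟨C, hC⟩ := hM.exists_wellInside X τ O.1
  have hCτ : Sub E C τ := fun P hP => ((hC P).1 hP).1
  obtain ⟨P, hPC, hyP⟩ := ((π.isPointFilter y).union_mem_iff C O hCτ
    (hX.isUnion_wellInside hM O.2 hC)).1 hyO
  obtain ⟨-, Q, hQ, hPQ, hcover⟩ := (hC P).1 hPC
  obtain ⟨e, he, hempty⟩ := hX.isTopology.empty_mem
  -- The complement of `π(Q)` is closed, contains `π(P)` since `P ∩ Q = ∅`, and lies in `π(O)` since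
  -- `Q ∪ O = X`.
  refine ⟨(π.op ⟨Q, hQ⟩)ᶜ, ?_, (π.basis.isOpen ⟨_, rfl⟩).isClosed_compl, ?_⟩
  · refine Filter.mem_of_superset ((π.basis.isOpen ⟨P, rfl⟩).mem_nhds hyP) fun z hzP hzQ => ?_
    refine (π.isPointFilter z).empty_notMem ⟨e, he⟩ hempty ?_
    exact ((π.isPointFilter z).mem_and_mem_iff hM hX.isTopology (O := P) (P := ⟨Q, hQ⟩)
      fun x => ⟨fun h => (hempty x h).elim, fun h => (hPQ x h.1 h.2).elim⟩).2 ⟨hzP, hzQ⟩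
  · intro z hz
    have hXτ := hX.isTopology.whole_mem
    refine hOs ((((π.isPointFilter z).mem_or_mem_iff hM (O := ⟨Q, hQ⟩) (P := O)
      (Q := ⟨X, hXτ⟩) fun x => ⟨hcover x, ?_⟩).1
        ((π.isPointFilter z).whole_mem _ rfl)).resolve_left hz)
    exact fun h => h.elim (hX.isTopology.sub Q hQ x) (hX.isTopology.sub _ O.2 x)

/-- Both composites of the two reductions preserve the point filter of each point, so they are
identities by `T₀`. -/
theorem Reducible.equivalent {π₀ π₁ : Preinterpretation.{u, w} E X τ} (h₀₁ : Reducible π₀ π₁)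
    (h₁₀ : Reducible π₁ π₀) : Equivalent π₀ π₁ := by
  obtain ⟨f, hf⟩ := h₀₁
  obtain ⟨g, hg⟩ := h₁₀
  have hf' : ∀ y O, f y ∈ π₁.op O ↔ y ∈ π₀.op O := fun y O => by rw [← hf.2 O, Set.mem_preimage]
  have hg' : ∀ y O, g y ∈ π₀.op O ↔ y ∈ π₁.op O := fun y O => by rw [← hg.2 O, Set.mem_preimage]
  refine ⟨f, hf, Function.bijective_iff_has_inverse.2 ⟨g, fun y => ?_, fun y => ?_⟩⟩
  · exact π₀.eq_of_forall_mem_op_iff fun O => by rw [hg', hf']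
  · exact π₁.eq_of_forall_mem_op_iff fun O => by rw [hf', hg']

/-! ### The largest preinterpretation -/

section PointFilters

variable [Small.{w} (Ext E τ)]

variable (E X τ) in
/-- The space of all point filters, as a type in the universe `w`. -/
def PointFilters : Type w :=
  {S : Set (Shrink.{w} (Ext E τ)) // IsPointFilter E X τ (equivShrink (Ext E τ) ⁻¹' S)}

/-- The point filter with a given set of members. -/
def PointFilters.mk {S : Set (Ext E τ)} (hS : IsPointFilter E X τ S) : PointFilters.{u, w} E X τ :=
  ⟨(equivShrink (Ext E τ)).symm ⁻¹' S, by simpa [← Set.preimage_comp] using hS⟩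

/-- The set of all point filters that contain `O`. -/
def PointFilters.basicOpen (O : Ext E τ) : Set (PointFilters.{u, w} E X τ) :=
  {p | equivShrink (Ext E τ) O ∈ p.1}

@[simp]
theorem PointFilters.mk_mem_basicOpen {S : Set (Ext E τ)} (hS : IsPointFilter E X τ S)
    (O : Ext E τ) : PointFilters.mk.{u, w} hS ∈ PointFilters.basicOpen O ↔ O ∈ S := by
  change (equivShrink (Ext E τ)).symm (equivShrink (Ext E τ) O) ∈ S ↔ O ∈ S
  rw [Equiv.symm_apply_apply]

theorem PointFilters.isPointFilter (p : PointFilters.{u, w} E X τ) :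
    IsPointFilter E X τ {O | p ∈ PointFilters.basicOpen O} := p.2

theorem PointFilters.ext {p q : PointFilters.{u, w} E X τ}
    (h : ∀ O, p ∈ PointFilters.basicOpen O ↔ q ∈ PointFilters.basicOpen O) : p = q := by
  refine Subtype.ext (Set.ext fun s => ?_)
  simpa [PointFilters.basicOpen] using h ((equivShrink (Ext E τ)).symm s)

instance : TopologicalSpace (PointFilters.{u, w} E X τ) :=
  TopologicalSpace.generateFrom (Set.range PointFilters.basicOpen)

theorem PointFilters.isTopologicalBasis (hM : IsModelZFC E) (hX : IsTopology E X τ) :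
    TopologicalSpace.IsTopologicalBasis
      (Set.range (PointFilters.basicOpen (E := E) (X := X) (τ := τ))) where
  exists_subset_inter := by
    rintro _ ⟨O, rfl⟩ _ ⟨P, rfl⟩ p hp
    obtain ⟨Q, hQ, hQOP⟩ := hX.inter_mem O.1 P.1 O.2 P.2
    have key := fun q : PointFilters.{u, w} E X τ =>
      q.isPointFilter.mem_and_mem_iff hM hX (Q := ⟨Q, hQ⟩) hQOP
    exact ⟨_, ⟨⟨Q, hQ⟩, rfl⟩, (key p).2 hp, fun q hq => (key q).1 hq⟩
  sUnion_eq := Set.eq_univ_of_forall fun p =>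
    ⟨_, ⟨⟨X, hX.whole_mem⟩, rfl⟩, p.isPointFilter.whole_mem _ rfl⟩
  eq_generateFrom := rfl

instance : T0Space (PointFilters.{u, w} E X τ) where
  t0 _ _ h := PointFilters.ext fun O =>
    h.mem_open_iff (TopologicalSpace.isOpen_generateFrom_of_mem ⟨O, rfl⟩)

/-- The preinterpretation whose points are the point filters. -/
def pointFilters (hM : IsModelZFC E) (hX : IsTopology E X τ) :
    Preinterpretation.{u, w} E X τ where
  Carrier := PointFilters.{u, w} E X τ
  pt x := PointFilters.mk (isPointFilter_pt x)
  op := PointFilters.basicOpen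
  mem_iff x O := by simp
  map_inter F P hF hfin hP := by
    ext p
    simpa using p.isPointFilter.inter_mem_iff F P hF hfin hP
  map_union C O hC hO := by
    ext p
    simpa using p.isPointFilter.union_mem_iff C O hC hO
  map_empty O hO := Set.eq_empty_of_forall_notMem fun p => p.isPointFilter.empty_notMem O hO
  map_whole O hO := Set.eq_univ_of_forall fun p => p.isPointFilter.whole_mem O hO
  basis := PointFilters.isTopologicalBasis hM hX

theorem isInterpretation_pointFilters (hM : IsModelZFC E) (hX : IsTopology E X τ) :
    (pointFilters.{u, w} hM hX).IsInterpretation := by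
  intro π
  refine ⟨fun y => PointFilters.mk (π.isPointFilter y), funext fun x => ?_, fun O => ?_⟩
  · refine PointFilters.ext fun O => ?_
    simp [pointFilters, π.mem_iff]
  · ext y
    simp [pointFilters]

end PointFilters

end Preinterpretation

end Model

end SetModel

/-- `⟨M, E⟩` is a model of ZFC and `⟨X, τ⟩` is a regular Hausdorff space in it. The universe `w`
plays the role of the surrounding set-theoretic universe: `M` may be a proper class relative to
it, but (the extensions of) `X` and `τ` are sets. -/
theorem mainTheorem1 {M : Type u} (E : M → M → Prop) (hM : SetModel.IsModelZFC E) (X τ : M)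
    [Small.{w} (SetModel.Ext E X)] [Small.{w} (SetModel.Ext E τ)]
    (hX : SetModel.IsRegularHausdorff E X τ) :
    (∃ π : SetModel.Preinterpretation.{u, w} E X τ, π.IsInterpretation) ∧
    (∀ π π' : SetModel.Preinterpretation.{u, w} E X τ,
      π.IsInterpretation → π'.IsInterpretation → π.Equivalent π') ∧
    (∀ π : SetModel.Preinterpretation.{u, w} E X τ,
      π.IsInterpretation → RegularSpace π.Carrier ∧ T2Space π.Carrier) := by
  refine ⟨⟨_, SetModel.Preinterpretation.isInterpretation_pointFilters hM hX.isTopology⟩,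
    fun π π' h h' => (h' π).equivalent (h π'), fun π _ => ?_⟩
  have := π.regularSpace hM hX
  exact ⟨this, inferInstance⟩
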